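/- Let $n\ge 1$, let $\Omega\subset\mathbb{R}^n$ be a bounded open set and let $c\in\mathbb{R}$. For a real symmetric $n\times n$ matrix $A$ with eigenvalues $\lambda_1,\dots,\lambda_n$ (counted with multiplicity) put $F(A)=\sum_{i=1}^n\arctan\lambda_i$. A function $u$ is a viscosity subsolution of the special Lagrangian equation $F(D^2u)=c$ in $\Omega$ if $F(D^2\varphi(x))\ge c$ whenever $x\in\Omega$, $\varphi$ is $C^2$ near $x$ and $u-\varphi$ has a local maximum at $x$; a function $v$ is a viscosity supersolution if $F(D^2\varphi(x))\le c$ whenever $x\in\Omega$, $\varphi$ is $C^2$ near $x$ and $v-\varphi$ has a local minimum at $x$. Let $u:\overline\Omega\to\mathbb{R}$ be an upper semicontinuous function that is a viscosity subsolution of $F(D^2u)=c$ in $\Omega$, and let $v:\overline\Omega\to\mathbb{R}$ be a lower semicontinuous function that is a viscosity supersolution of $F(D^2v)=c$ in $\Omega$. If $u\le v$ on $\partial\Omega$, then $u\le v$ in $\Omega$. -/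

import Mathlib

open Set Topology

namespace SpecialLagrangian

/-- The Hessian matrix `D²φ(x)`, with entries the second partial derivatives of `φ` at `x`. -/
noncomputable def hessian {n : ℕ} (φ : EuclideanSpace ℝ (Fin n) → ℝ)
    (x : EuclideanSpace ℝ (Fin n)) : Matrix (Fin n) (Fin n) ℝ :=
  Matrix.of fun i j =>
    fderiv ℝ (fderiv ℝ φ) x (EuclideanSpace.single i 1) (EuclideanSpace.single j 1)

/-- The operator `F(A) = ∑ i, arctan λ_i`, where the `λ_i` are the (real) eigenvalues of `A`,
repeated according to algebraic multiplicity. It is only used for symmetric `A`; see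
`phase_eq_sum_eigenvalues`. -/
noncomputable def phase {n : ℕ} (A : Matrix (Fin n) (Fin n) ℝ) : ℝ :=
  (A.charpoly.roots.map Real.arctan).sum

/-- `u` is a viscosity subsolution of `∑ i, arctan λ_i(D²u) = c` in the open set `Ω`: whenever
`φ` is of class `C²` near `x ∈ Ω` and `u - φ` has a local maximum at `x`, `F(D²φ(x)) ≥ c`. -/
def IsViscositySubsolution {n : ℕ} (c : ℝ) (Ω : Set (EuclideanSpace ℝ (Fin n)))
    (u : EuclideanSpace ℝ (Fin n) → ℝ) : Prop :=
  ∀ x ∈ Ω, ∀ φ : EuclideanSpace ℝ (Fin n) → ℝ, ContDiffAt ℝ 2 φ x →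
    IsLocalMax (fun y => u y - φ y) x → c ≤ phase (hessian φ x)

/-- `v` is a viscosity supersolution of `∑ i, arctan λ_i(D²v) = c` in the open set `Ω`: whenever
`φ` is of class `C²` near `x ∈ Ω` and `v - φ` has a local minimum at `x`, `F(D²φ(x)) ≤ c`. -/
def IsViscositySupersolution {n : ℕ} (c : ℝ) (Ω : Set (EuclideanSpace ℝ (Fin n)))
    (v : EuclideanSpace ℝ (Fin n) → ℝ) : Prop :=
  ∀ x ∈ Ω, ∀ φ : EuclideanSpace ℝ (Fin n) → ℝ, ContDiffAt ℝ 2 φ x →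
    IsLocalMin (fun y => v y - φ y) x → phase (hessian φ x) ≤ c

theorem phase_eq_sum_eigenvalues {n : ℕ} {A : Matrix (Fin n) (Fin n) ℝ} (hA : A.IsHermitian) :
    phase A = ∑ i, Real.arctan (hA.eigenvalues i) := by
  unfold phase
  rw [hA.roots_charpoly_eq_eigenvalues]
  simp [List.sum_ofFn]

theorem hessian_isHermitian {n : ℕ} {φ : EuclideanSpace ℝ (Fin n) → ℝ}
    {x : EuclideanSpace ℝ (Fin n)} (h : ContDiffAt ℝ 2 φ x) : (hessian φ x).IsHermitian := by
  have hs : IsSymmSndFDerivAt ℝ φ x := h.isSymmSndFDerivAt (by simp)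
  ext i j
  simpa [hessian] using hs.eq _ _

end SpecialLagrangian

namespace SpecialLagrangian

open Filter MeasureTheory Metric
open scoped ENNReal NNReal RealInnerProductSpace

/-! Suppose `u - v` is positive somewhere. Add a small multiple of `‖·‖²` to `u`, and regularize
this function and `-v` by sup-convolution on the compact closure. Up to the term `k / 2 * ‖·‖²` the
regularizations are convex functions `F`, `G`, whose subgradients are `k` times the maximizing
points `s x`, `t x`. For strong penalization and small `p`, at every maximum of `F + G - k‖·‖² - ⟪p,
·⟫` both of these points lie in `Ω`.

Jensen's lemma (`exists_max_differentiableAt`) gives such a maximum at which both subgradient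
selections are differentiable. Alexandrov's theorem is avoided: at maximum points `F` and `G` are
touched from above by paraboloids, so the selections are Lipschitz there and a Stepanov argument
applies.

The resulting second order expansions pass to `u` at `s x` and to `v` at `t x`, and give matrices
with `c ≤ phase X` and `phase Y ≤ c`. The maximum condition and the added quadratic force `X < Y`,
against strict monotonicity of `phase`. The two base points may differ because the equation sees
only the Hessian; no uniform ellipticity is needed. -/

/-! ### Strict monotonicity of the phase. -/

/-- Weyl's monotonicity of ordered eigenvalues, for quadratic forms diagonalized in orthonormal
bases. -/
theorem lt_of_sum_mul_inner_sq_lt {E : Type*} [NormedAddCommGroup E] [InnerProductSpace ℝ E]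
    [FiniteDimensional ℝ E] {m : ℕ} (b b' : OrthonormalBasis (Fin m) ℝ E) {l l' : Fin m → ℝ}
    (hl : Antitone l) (hl' : Antitone l')
    (h : ∀ x : E, x ≠ 0 → ∑ i, l i * ⟪b i, x⟫ ^ 2 < ∑ i, l' i * ⟪b' i, x⟫ ^ 2) (i : Fin m) :
    l i < l' i := by
  have hm : Module.finrank ℝ E = m := by simpa using Module.finrank_eq_card_basis b.toBasis
  set V := Submodule.span ℝ (b '' Iic i) with hV
  set W := Submodule.span ℝ (b' '' Ici i) with hW
  have hVr : Module.finrank ℝ V = i + 1 := by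
    rw [hV, image_eq_range]
    exact (finrank_span_eq_card
      (b.orthonormal.linearIndependent.comp _ Subtype.val_injective)).trans
      ((Fintype.card_of_subtype (Finset.Iic i) (by simp)).trans (by simp))
  have hWr : Module.finrank ℝ W = m - i := by
    rw [hW, image_eq_range]
    exact (finrank_span_eq_card
      (b'.orthonormal.linearIndependent.comp _ Subtype.val_injective)).trans
      ((Fintype.card_of_subtype (Finset.Ici i) (by simp)).trans (by simp))
  -- The dimensions `i + 1` and `m - i` add up to more than `m`, so the spans meet nontrivially.
  obtain ⟨x, hxV, hxW, hx0⟩ : ∃ x, x ∈ V ∧ x ∈ W ∧ x ≠ 0 := by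
    by_contra! hcon
    have hd : V ⊓ W = ⊥ := by
      rw [eq_bot_iff]
      rintro x ⟨h1, h2⟩
      simpa using hcon x h1 h2
    have h1 := Submodule.finrank_sup_add_finrank_inf_eq V W
    rw [hd, hVr, hWr, finrank_bot] at h1
    have h2 := Submodule.finrank_le (V ⊔ W)
    omega
  have hVz : ∀ j, i < j → ⟪b j, x⟫ = 0 := by
    intro j hj
    have : V ≤ (Submodule.span ℝ {b j})ᗮ := by
      rw [hV, Submodule.span_le]
      rintro _ ⟨k, hk, rfl⟩
      rw [SetLike.mem_coe, Submodule.mem_orthogonal_singleton_iff_inner_right]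
      exact b.orthonormal.2 (lt_of_le_of_lt hk hj).ne'
    exact Submodule.mem_orthogonal_singleton_iff_inner_right.1 (this hxV)
  have hWz : ∀ j, j < i → ⟪b' j, x⟫ = 0 := by
    intro j hj
    have : W ≤ (Submodule.span ℝ {b' j})ᗮ := by
      rw [hW, Submodule.span_le]
      rintro _ ⟨k, hk, rfl⟩
      rw [SetLike.mem_coe, Submodule.mem_orthogonal_singleton_iff_inner_right]
      exact b'.orthonormal.2 (lt_of_lt_of_le hj hk).ne
    exact Submodule.mem_orthogonal_singleton_iff_inner_right.1 (this hxW)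
  have e1 : l i * ‖x‖ ^ 2 ≤ ∑ j, l j * ⟪b j, x⟫ ^ 2 := by
    rw [← b.sum_sq_norm_inner_right x, Finset.mul_sum]
    refine Finset.sum_le_sum fun j _ => ?_
    rcases le_or_gt j i with hj | hj
    · simpa using mul_le_mul_of_nonneg_right (hl hj) (sq_nonneg ⟪b j, x⟫)
    · simp [hVz j hj]
  have e2 : ∑ j, l' j * ⟪b' j, x⟫ ^ 2 ≤ l' i * ‖x‖ ^ 2 := by
    rw [← b'.sum_sq_norm_inner_right x, Finset.mul_sum]
    refine Finset.sum_le_sum fun j _ => ?_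
    rcases le_or_gt i j with hj | hj
    · simpa using mul_le_mul_of_nonneg_right (hl' hj) (sq_nonneg ⟪b' j, x⟫)
    · simp [hWz j hj]
  have hx : 0 < ‖x‖ ^ 2 := by positivity
  exact lt_of_mul_lt_mul_right (e1.trans_lt ((h x hx0).trans_le e2)) hx.le

theorem inner_toEuclideanLin_eq_sum {n : ℕ} {A : Matrix (Fin n) (Fin n) ℝ}
    (hA : A.IsHermitian) (x : EuclideanSpace ℝ (Fin n)) :
    ⟪x, Matrix.toEuclideanLin A x⟫ =
      ∑ i, hA.eigenvalues i * ⟪hA.eigenvectorBasis i, x⟫ ^ 2 := by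
  rw [← hA.eigenvectorBasis.sum_inner_mul_inner]
  refine Finset.sum_congr rfl fun i _ => ?_
  have hs := Matrix.isSymmetric_toEuclideanLin_iff.mpr hA
  have he : Matrix.toEuclideanLin A (hA.eigenvectorBasis i)
      = hA.eigenvalues i • hA.eigenvectorBasis i := by
    ext j
    simpa using congrFun (hA.mulVec_eigenvectorBasis i) j
  rw [← hs, he, real_inner_smul_left, real_inner_comm]
  ring

theorem phase_lt_phase {n : ℕ} (hn : 0 < n) {A B : Matrix (Fin n) (Fin n) ℝ}
    (hA : A.IsHermitian) (hB : B.IsHermitian)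
    (h : ∀ x : EuclideanSpace ℝ (Fin n), x ≠ 0 →
      ⟪x, Matrix.toEuclideanLin A x⟫ < ⟪x, Matrix.toEuclideanLin B x⟫) :
    phase A < phase B := by
  rw [phase_eq_sum_eigenvalues hA, phase_eq_sum_eigenvalues hB]
  have hne : Nonempty (Fin n) := ⟨⟨0, hn⟩⟩
  refine Finset.sum_lt_sum_of_nonempty Finset.univ_nonempty fun i _ =>
    Real.arctan_strictMono ?_
  -- This is the reindexing hidden in `eigenvalues`; the sorted list is `eigenvalues₀`.
  set e : Fin (Fintype.card (Fin n)) ≃ Fin n := Fintype.equivOfCardEq (Fintype.card_fin _) with he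
  have key := lt_of_sum_mul_inner_sq_lt (hA.eigenvectorBasis.reindex e.symm)
    (hB.eigenvectorBasis.reindex e.symm) hA.eigenvalues₀_antitone hB.eigenvalues₀_antitone ?_
    (e.symm i)
  · exact key
  · intro x hx
    have := h x hx
    rw [inner_toEuclideanLin_eq_sum hA, inner_toEuclideanLin_eq_sum hB] at this
    rw [← e.sum_comp, ← e.sum_comp] at this
    simpa [Matrix.IsHermitian.eigenvalues, he] using this

/-! ### Stepanov-type differentiability at density points. -/

section Stepanov

variable {E F : Type*} [NormedAddCommGroup E] [NormedSpace ℝ E] [FiniteDimensional ℝ E]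
  [MeasurableSpace E] [BorelSpace E] (μ : Measure E) [μ.IsAddHaarMeasure]
  [NormedAddCommGroup F] [NormedSpace ℝ F]

/-- Near a density point `x` of `K`, every point `y` is at distance `o(|y - x|)` from `K`. -/
theorem eventually_exists_mem_dist_le_of_density_one {K : Set E} {x : E} (hxK : x ∈ K)
    (hx : Tendsto (fun r => μ (K ∩ closedBall x r) / μ (closedBall x r)) (𝓝[>] 0) (𝓝 1))
    {σ : ℝ} (hσ : 0 < σ) (hσ1 : σ ≤ 1) :
    ∀ᶠ y in 𝓝 x, ∃ y' ∈ K, dist y y' ≤ σ * dist y x := by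
  set d := Module.finrank ℝ E
  -- The volume of a ball of radius `σ * r` relative to one of radius `2 * r`: a hole of this
  -- proportion contradicts density one.
  set q : ℝ := (σ / 2) ^ d
  have hq : 0 < q := by positivity
  have hlim : ∀ᶠ r in 𝓝[>] (0 : ℝ),
      ENNReal.ofReal (1 - q) < μ (K ∩ closedBall x r) / μ (closedBall x r) := by
    refine hx.eventually_const_lt ?_
    rw [ENNReal.ofReal_lt_one]
    linarith
  obtain ⟨r₀, hr₀, H⟩ := mem_nhdsGT_iff_exists_Ioo_subset.1 hlim
  filter_upwards [ball_mem_nhds x (half_pos hr₀)] with y hy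
  rcases eq_or_ne y x with rfl | hyx
  · exact ⟨y, hxK, by simp⟩
  by_contra! hcon
  set r := dist y x
  have hr : 0 < r := dist_pos.2 hyx
  have hy' : r < r₀ / 2 := hy
  have h2 : 2 * r ∈ Ioo (0 : ℝ) r₀ := ⟨by positivity, by linarith⟩
  have hlt := H h2
  set B := closedBall x (2 * r)
  have hsub : closedBall y (σ * r) ⊆ B := by
    refine closedBall_subset_closedBall' ?_
    change σ * r + r ≤ 2 * r
    nlinarith
  have hKsub : K ∩ B ⊆ B \ closedBall y (σ * r) := by
    rintro z ⟨hz, hzB⟩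
    refine ⟨hzB, fun hzy => ?_⟩
    have := hcon z hz
    rw [mem_closedBall, dist_comm] at hzy
    linarith
  have hBfin : μ B ≠ ∞ := measure_closedBall_lt_top.ne
  have hmeas : μ (closedBall y (σ * r)) = ENNReal.ofReal q * μ B := by
    have : σ * r = (σ / 2) * (2 * r) := by ring
    rw [this, Measure.addHaar_closedBall_mul_of_pos μ y (by positivity),
      ← Measure.addHaar_closedBall_center μ x]
  have hle : μ (K ∩ B) ≤ ENNReal.ofReal (1 - q) * μ B := by
    refine (measure_mono hKsub).trans ?_
    rw [measure_sdiff hsub measurableSet_closedBall.nullMeasurableSet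
      measure_closedBall_lt_top.ne, hmeas, ENNReal.ofReal_sub _ hq.le, ENNReal.ofReal_one,
      ENNReal.sub_mul (by simp [hBfin]), one_mul]
  have := ENNReal.div_le_of_le_mul hle
  exact absurd hlt (not_lt.2 this)

/-- Replace `y` by a point `y'` of `K` at distance `o(‖y - x‖)`. The derivative within `K` controls
`S y' - S x`, and the Lipschitz bound at `y'`, valid against all points, controls `S y - S y'`. -/
theorem hasFDerivAt_of_hasFDerivWithinAt_of_density_one {K : Set E} {S : E → F} {C : ℝ}
    (hC : ∀ x ∈ K, ∀ y, ‖S y - S x‖ ≤ C * ‖y - x‖) {x : E} (hxK : x ∈ K) {A : E →L[ℝ] F}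
    (hA : HasFDerivWithinAt S A K x)
    (hx : Tendsto (fun r => μ (K ∩ closedBall x r) / μ (closedBall x r)) (𝓝[>] 0) (𝓝 1)) :
    HasFDerivAt S A x := by
  rw [hasFDerivAt_iff_isLittleO, Asymptotics.isLittleO_iff]
  intro ε hε
  set D := |C| + ‖A‖ + 1
  have hD : 0 < D := by positivity
  set σ := min 1 (ε / (2 * D))
  have hσ : 0 < σ := by positivity
  have hσ1 : σ ≤ 1 := min_le_left _ _
  have hσD : σ * D ≤ ε / 2 := by
    have : σ ≤ ε / (2 * D) := min_le_right _ _
    calc σ * D ≤ ε / (2 * D) * D := by gcongr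
      _ = ε / 2 := by field_simp
  have h1 := (hasFDerivWithinAt_iff_isLittleO.1 hA)
  rw [Asymptotics.isLittleO_iff] at h1
  have h2 := h1 (show 0 < ε / 4 by positivity)
  rw [eventually_nhdsWithin_iff, Metric.eventually_nhds_iff] at h2
  obtain ⟨r, hr, h2⟩ := h2
  filter_upwards [eventually_exists_mem_dist_le_of_density_one μ hxK hx hσ hσ1,
    ball_mem_nhds x (half_pos hr)] with y ⟨y', hy'K, hy'⟩ hyr
  rw [mem_ball] at hyr
  rw [dist_eq_norm, dist_eq_norm] at hy'
  have hy'x : ‖y' - x‖ ≤ 2 * ‖y - x‖ := by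
    calc ‖y' - x‖ = ‖(y - x) - (y - y')‖ := by congr 1; abel
      _ ≤ ‖y - x‖ + ‖y - y'‖ := norm_sub_le _ _
      _ ≤ 2 * ‖y - x‖ := by nlinarith [norm_nonneg (y - x)]
  have h3 := h2 (y := y') (by rw [dist_eq_norm] at hyr ⊢; linarith) hy'K
  have h4 := hC y' hy'K y
  have h5 : ‖A (y - y')‖ ≤ ‖A‖ * ‖y - y'‖ := A.le_opNorm _
  have h6 : S y - S x - A (y - x) = (S y - S y') + (S y' - S x - A (y' - x)) - A (y - y') := by
    have : y - x = (y' - x) + (y - y') := by abel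
    rw [this, map_add]
    abel
  have h7 : C * ‖y - y'‖ ≤ |C| * ‖y - y'‖ := by gcongr; exact le_abs_self C
  calc ‖S y - S x - A (y - x)‖ ≤ ‖S y - S y'‖ + ‖S y' - S x - A (y' - x)‖ + ‖A (y - y')‖ := by
        rw [h6]
        exact (norm_sub_le _ _).trans (by gcongr; exact norm_add_le _ _)
    _ ≤ D * ‖y - y'‖ + ε / 4 * ‖y' - x‖ := by
        have : D * ‖y - y'‖ = |C| * ‖y - y'‖ + ‖A‖ * ‖y - y'‖ + ‖y - y'‖ := by ring
        have := norm_nonneg (y - y')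
        linarith
    _ ≤ D * (σ * ‖y - x‖) + ε / 4 * (2 * ‖y - x‖) := by gcongr
    _ = (σ * D) * ‖y - x‖ + ε / 2 * ‖y - x‖ := by ring
    _ ≤ (ε / 2) * ‖y - x‖ + ε / 2 * ‖y - x‖ := by gcongr
    _ = ε * ‖y - x‖ := by ring

/-- A map which is Lipschitz at each point of `K`, with a uniform constant, is differentiable at
almost every point of `K`. -/
theorem ae_differentiableAt_of_pointwise_lipschitz [FiniteDimensional ℝ F] {K : Set E}
    {S : E → F} {C : ℝ} (hC : ∀ x ∈ K, ∀ y, ‖S y - S x‖ ≤ C * ‖y - x‖) :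
    ∀ᵐ x ∂μ, x ∈ K → DifferentiableAt ℝ S x := by
  have hL : LipschitzOnWith C.toNNReal S K := by
    refine LipschitzOnWith.of_dist_le_mul fun y _ x hx => ?_
    rw [dist_eq_norm, dist_eq_norm]
    refine (hC x hx y).trans ?_
    gcongr
    exact Real.le_coe_toNNReal C
  -- Both almost-everywhere statements hold for arbitrary `K`, so measurability is never checked.
  filter_upwards [hL.ae_differentiableWithinAt_of_mem (μ := μ),
    ae_imp_of_ae_restrict (Besicovitch.ae_tendsto_measure_inter_div μ K)] with x h1 h2 hx
  exact (hasFDerivAt_of_hasFDerivWithinAt_of_density_one μ hC hx (h1 hx).hasFDerivWithinAt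
    (h2 hx)).differentiableAt

end Stepanov

/-! ### Second order expansion of convex functions and Jensen's lemma. -/

/-- Telescoping over `N + 1` equal steps leaves an error `M / (N + 1)`. This replaces integration of
the subgradient along a segment, with no regularity of `ψ`. -/
theorem le_of_sub_le_mul_sq {ψ : ℝ → ℝ} {M : ℝ}
    (h : ∀ s t, 0 ≤ s → s ≤ t → t ≤ 1 → ψ t - ψ s ≤ M * (t - s) ^ 2) : ψ 1 ≤ ψ 0 := by
  have key : ∀ N : ℕ, ψ 1 ≤ ψ 0 + M / ((N : ℝ) + 1) := by
    intro N
    have hN : (0 : ℝ) < (N : ℝ) + 1 := by positivity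
    have step : ∀ j : ℕ, j ≤ N + 1 →
        ψ (j / ((N : ℝ) + 1)) ≤ ψ 0 + j * (M / ((N : ℝ) + 1) ^ 2) := by
      intro j
      induction j with
      | zero => simp
      | succ j ih =>
        intro hj
        have h1 := ih (by omega)
        have hj' : ((j : ℝ) + 1) ≤ (N : ℝ) + 1 := by exact_mod_cast hj
        have h2 := h (j / ((N : ℝ) + 1)) ((j + 1 : ℝ) / ((N : ℝ) + 1)) (by positivity)
          (by gcongr; linarith) (by rw [div_le_one hN]; exact hj')
        have h3 : M * ((j + 1 : ℝ) / ((N : ℝ) + 1) - j / ((N : ℝ) + 1)) ^ 2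
            = M / ((N : ℝ) + 1) ^ 2 := by
          field_simp
          ring
        push_cast
        linarith
    have h4 := step (N + 1) le_rfl
    push_cast at h4
    rw [div_self hN.ne'] at h4
    convert h4 using 2
    field_simp
  have hlim : Tendsto (fun N : ℕ => ψ 0 + M / ((N : ℝ) + 1)) atTop (𝓝 (ψ 0 + 0)) := by
    refine tendsto_const_nhds.add ?_
    have := (tendsto_const_div_atTop_nhds_zero_nat M).comp (tendsto_add_atTop_nat 1)
    simpa [Function.comp_def] using this
  rw [add_zero] at hlim
  exact ge_of_tendsto' hlim key

section Subgradient

variable {E : Type*} [NormedAddCommGroup E] [InnerProductSpace ℝ E]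

/-- A convex function has a second order expansion at each point of differentiability of a
selection of its subdifferential. -/
theorem eventually_abs_sub_quadratic_le {F : E → ℝ} {S : E → E}
    (hF : ∀ x y, F x + ⟪S x, y - x⟫ ≤ F y) {A : E →L[ℝ] E} {x : E} (hA : HasFDerivAt S A x)
    {σ : ℝ} (hσ : 0 < σ) :
    ∀ᶠ h in 𝓝 (0 : E), |F (x + h) - F x - ⟪S x, h⟫ - ⟪A h, h⟫ / 2| ≤ σ * ‖h‖ ^ 2 := by
  have h1 := hasFDerivAt_iff_isLittleO_nhds_zero.1 hA
  rw [Asymptotics.isLittleO_iff] at h1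
  have h2 := h1 hσ
  rw [Metric.eventually_nhds_iff] at h2
  obtain ⟨r, hr, h2⟩ := h2
  filter_upwards [ball_mem_nhds (0 : E) hr] with h hh
  rw [mem_ball, dist_zero_right] at hh
  set a := ⟪A h, h⟫
  have bound : ∀ t : ℝ, 0 ≤ t → t ≤ 1 →
      |⟪S (x + t • h), h⟫ - ⟪S x, h⟫ - t * a| ≤ σ * ‖h‖ ^ 2 := by
    intro t ht0 ht1
    have hn : ‖t • h‖ ≤ ‖h‖ := by
      rw [norm_smul, Real.norm_of_nonneg ht0]
      exact mul_le_of_le_one_left (norm_nonneg h) ht1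
    have h3 := h2 (y := t • h) (by rw [dist_zero_right]; linarith)
    have h4 : ⟪S (x + t • h), h⟫ - ⟪S x, h⟫ - t * a = ⟪S (x + t • h) - S x - A (t • h), h⟫ := by
      rw [inner_sub_left, inner_sub_left, map_smul, real_inner_smul_left]
    rw [h4]
    calc |⟪S (x + t • h) - S x - A (t • h), h⟫| ≤ ‖S (x + t • h) - S x - A (t • h)‖ * ‖h‖ :=
          abs_real_inner_le_norm _ _
      _ ≤ (σ * ‖h‖) * ‖h‖ := by
          gcongr
          exact h3.trans (by gcongr)
      _ = σ * ‖h‖ ^ 2 := by ring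
  have sub1 : ∀ s t : ℝ, (t - s) * ⟪S (x + s • h), h⟫ ≤ F (x + t • h) - F (x + s • h) := by
    intro s t
    have h3 := hF (x + s • h) (x + t • h)
    have h4 : x + t • h - (x + s • h) = (t - s) • h := by rw [sub_smul]; abel
    rw [h4, real_inner_smul_right] at h3
    linarith
  -- The subgradient at the right endpoint overshoots the integral of `t * a` by `a / 2 * (t - s) ^
  -- 2`; for `lower`, the left endpoint gives the same error.
  have upper := le_of_sub_le_mul_sq (M := a / 2)
    (ψ := fun t => F (x + t • h) - t * ⟪S x, h⟫ - t ^ 2 / 2 * a - t * (σ * ‖h‖ ^ 2)) (by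
      intro s t hs hst ht
      have h3 := sub1 t s
      have h4 := (abs_le.1 (bound t (hs.trans hst) ht)).2
      have h5 := mul_le_mul_of_nonneg_left h4 (sub_nonneg.2 hst)
      linarith)
  have lower := le_of_sub_le_mul_sq (M := a / 2)
    (ψ := fun t => -F (x + t • h) + t * ⟪S x, h⟫ + t ^ 2 / 2 * a - t * (σ * ‖h‖ ^ 2)) (by
      intro s t hs hst ht
      have h3 := sub1 s t
      have h4 := (abs_le.1 (bound s hs (hst.trans ht))).1
      have h5 := mul_le_mul_of_nonneg_left h4 (sub_nonneg.2 hst)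
      linarith)
  simp only [one_smul, zero_smul, add_zero] at upper lower
  rw [abs_le]
  constructor <;> linarith

theorem eq_zero_of_forall_inner_le_mul_sq {q : E} {k : ℝ} (h : ∀ z : E, ⟪q, z⟫ ≤ k * ‖z‖ ^ 2) :
    q = 0 := by
  by_contra hq
  have hq' : 0 < ‖q‖ ^ 2 := by positivity
  set t := 1 / (|k| + 1)
  have ht : 0 < t := by positivity
  have h1 := h (t • q)
  rw [real_inner_smul_right, real_inner_self_eq_norm_sq, norm_smul, Real.norm_of_nonneg ht.le,
    mul_pow] at h1
  have h2 : t * (|k| + 1) = 1 := by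
    simp only [t]
    field_simp
  have h3 : t * ‖q‖ ^ 2 * (1 - k * t) ≤ 0 := by linarith
  have h4 : 0 < 1 - k * t := by nlinarith [le_abs_self k]
  have := mul_pos (mul_pos ht hq') h4
  linarith

variable {F G : E → ℝ} {S T : E → E} {k : ℝ}

/-- First order condition at a maximum point of `F + G - k‖·‖² - ⟪p, ·⟫`. -/
theorem add_eq_of_max (hF : ∀ x y, F x + ⟪S x, y - x⟫ ≤ F y)
    (hG : ∀ x y, G x + ⟪T x, y - x⟫ ≤ G y) {p x : E}
    (hx : ∀ y, F y + G y - k * ‖y‖ ^ 2 ≤ F x + G x - k * ‖x‖ ^ 2 + ⟪p, y - x⟫) :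
    S x + T x - (2 * k) • x = p := by
  refine sub_eq_zero.1 (eq_zero_of_forall_inner_le_mul_sq (k := k) fun z => ?_)
  have h1 := hF x (x + z)
  have h2 := hG x (x + z)
  have h3 := hx (x + z)
  rw [norm_add_sq_real] at h3
  simp only [add_sub_cancel_left] at h1 h2 h3
  simp only [inner_sub_left, inner_add_left, real_inner_smul_left]
  linarith

/-- At a maximum point of `F + G - k‖·‖² - ⟪p, ·⟫`, the convex function `F` is touched from above
by a paraboloid of opening `k`. -/
theorem le_add_mul_sq_of_max (hF : ∀ x y, F x + ⟪S x, y - x⟫ ≤ F y)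
    (hG : ∀ x y, G x + ⟪T x, y - x⟫ ≤ G y) {p x : E}
    (hx : ∀ y, F y + G y - k * ‖y‖ ^ 2 ≤ F x + G x - k * ‖x‖ ^ 2 + ⟪p, y - x⟫) (z : E) :
    F z ≤ F x + ⟪S x, z - x⟫ + k * ‖z - x‖ ^ 2 := by
  have h1 := hG x z
  have h2 := hx z
  have h3 : ‖z‖ ^ 2 = ‖x‖ ^ 2 + 2 * ⟪x, z - x⟫ + ‖z - x‖ ^ 2 := by
    rw [← norm_add_sq_real, add_sub_cancel]
  rw [← add_eq_of_max hF hG hx, inner_sub_left, inner_add_left, real_inner_smul_left, h3] at h2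
  linarith

/-- Evaluate at `y + D / (4 * k)`: the paraboloid from `x` lies above the supporting plane from `y`,
which gives a quadratic inequality in `‖D‖`. -/
theorem norm_sub_le_of_le_add_mul_sq (hk : 0 < k) (hF : ∀ x y, F x + ⟪S x, y - x⟫ ≤ F y) {x : E}
    (hx : ∀ z, F z ≤ F x + ⟪S x, z - x⟫ + k * ‖z - x‖ ^ 2) (y : E) :
    ‖S y - S x‖ ≤ 4 * k * ‖y - x‖ := by
  set D := S y - S x with hD
  set s := 1 / (4 * k)
  have hs : 0 < s := by positivity
  have hsk : 4 * (s * k) = 1 := by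
    simp only [s]
    field_simp
  have h1 := hx (y + s • D)
  have h2 := hF y (y + s • D)
  have h3 := hF x y
  have h4 : y + s • D - x = (y - x) + s • D := by abel
  rw [h4, inner_add_right, norm_add_sq_real, real_inner_smul_right, real_inner_smul_right,
    norm_smul, Real.norm_of_nonneg hs.le] at h1
  rw [add_sub_cancel_left, real_inner_smul_right] at h2
  have h5 : ⟪S y, D⟫ - ⟪S x, D⟫ = ‖D‖ ^ 2 := by
    rw [← inner_sub_left, ← hD, real_inner_self_eq_norm_sq]
  have h6 : ⟪y - x, D⟫ ≤ ‖y - x‖ * ‖D‖ := real_inner_le_norm _ _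
  have h7 : s * ‖D‖ ^ 2 ≤ k * (‖y - x‖ ^ 2 + 2 * (s * ⟪y - x, D⟫) + (s * ‖D‖) ^ 2) := by
    rw [← h5]
    linarith
  have h8 : ‖D‖ ^ 2 ≤ 4 * k * (k * ‖y - x‖ ^ 2) + 2 * k * (‖y - x‖ * ‖D‖) + ‖D‖ ^ 2 / 4 := by
    have e1 : 4 * k * (s * ‖D‖ ^ 2) = ‖D‖ ^ 2 := by linear_combination ‖D‖ ^ 2 * hsk
    have e2 : 4 * k * (k * (‖y - x‖ ^ 2 + 2 * (s * ⟪y - x, D⟫) + (s * ‖D‖) ^ 2))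
        = 4 * k * (k * ‖y - x‖ ^ 2) + 2 * k * ⟪y - x, D⟫ + ‖D‖ ^ 2 / 4 := by
      linear_combination (2 * k * ⟪y - x, D⟫ + ‖D‖ ^ 2 / 4 * (4 * (s * k) + 1)) * hsk
    have e3 := mul_le_mul_of_nonneg_left h7 (show 0 ≤ 4 * k by positivity)
    have e4 := mul_le_mul_of_nonneg_left h6 (show 0 ≤ 2 * k by positivity)
    linarith
  by_contra! hcon
  have h9 : 0 ≤ k * ‖y - x‖ := by positivity
  nlinarith

/-- Second order condition at a maximum point of `F + G - k‖·‖² - ⟪p, ·⟫`. -/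
theorem inner_add_inner_le_of_max (hF : ∀ x y, F x + ⟪S x, y - x⟫ ≤ F y)
    (hG : ∀ x y, G x + ⟪T x, y - x⟫ ≤ G y) {p x : E}
    (hx : ∀ y, F y + G y - k * ‖y‖ ^ 2 ≤ F x + G x - k * ‖x‖ ^ 2 + ⟪p, y - x⟫)
    {A B : E →L[ℝ] E} (hA : HasFDerivAt S A x) (hB : HasFDerivAt T B x) {σ : ℝ} (hσ : 0 < σ)
    (h : E) : ⟪A h, h⟫ + ⟪B h, h⟫ ≤ (2 * k + 4 * σ) * ‖h‖ ^ 2 := by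
  have hlim : Tendsto (fun t : ℝ => t • h) (𝓝[>] 0) (𝓝 0) := by
    have : Tendsto (fun t : ℝ => t • h) (𝓝 0) (𝓝 ((0 : ℝ) • h)) :=
      (continuous_id.smul continuous_const).tendsto 0
    rw [zero_smul] at this
    exact this.mono_left nhdsWithin_le_nhds
  obtain ⟨t, ⟨h1, h2⟩, ht⟩ := ((hlim.eventually ((eventually_abs_sub_quadratic_le hF hA hσ).and
    (eventually_abs_sub_quadratic_le hG hB hσ))).and self_mem_nhdsWithin).exists
  have ht' : 0 < t := ht
  have h3 := hx (x + t • h)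
  rw [← add_eq_of_max hF hG hx, add_sub_cancel_left, norm_add_sq_real] at h3
  have h4 := (abs_le.1 h1).1
  have h5 := (abs_le.1 h2).1
  simp only [map_smul, inner_sub_left, inner_add_left, real_inner_smul_left,
    real_inner_smul_right, norm_smul, Real.norm_of_nonneg ht'.le] at h3 h4 h5
  refine le_of_mul_le_mul_left ?_ (sq_pos_of_pos ht')
  linarith

variable [FiniteDimensional ℝ E]

/-- Jensen's lemma: if `F + G - k‖·‖²` attains a maximum after every small linear perturbation,
then some such maximum point is a point of differentiability of the selections `S` and `T` of the
subdifferentials of the convex functions `F` and `G`. -/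
theorem exists_max_differentiableAt (hk : 0 < k) (hF : ∀ x y, F x + ⟪S x, y - x⟫ ≤ F y)
    (hG : ∀ x y, G x + ⟪T x, y - x⟫ ≤ G y) {δ : ℝ} (hδ : 0 < δ)
    (hmax : ∀ p : E, ‖p‖ < δ → ∃ x, ∀ y,
      F y + G y - k * ‖y‖ ^ 2 ≤ F x + G x - k * ‖x‖ ^ 2 + ⟪p, y - x⟫) :
    ∃ p x : E, ‖p‖ < δ ∧
      (∀ y, F y + G y - k * ‖y‖ ^ 2 ≤ F x + G x - k * ‖x‖ ^ 2 + ⟪p, y - x⟫) ∧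
      DifferentiableAt ℝ S x ∧ DifferentiableAt ℝ T x := by
  borelize E
  -- In this dimension Hausdorff measure is both a Haar measure and well behaved under Lipschitz
  -- images.
  set μ : Measure E := Measure.hausdorffMeasure (Module.finrank ℝ E : ℝ)
  set K : Set E := {x | ∃ p : E, ‖p‖ < δ ∧
    ∀ y, F y + G y - k * ‖y‖ ^ 2 ≤ F x + G x - k * ‖x‖ ^ 2 + ⟪p, y - x⟫}
  set P : E → E := fun x => S x + T x - (2 * k) • x
  have hSK : ∀ x ∈ K, ∀ y, ‖S y - S x‖ ≤ 4 * k * ‖y - x‖ := by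
    rintro x ⟨p, -, hx⟩
    exact norm_sub_le_of_le_add_mul_sq hk hF (le_add_mul_sq_of_max hF hG hx)
  have hTK : ∀ x ∈ K, ∀ y, ‖T y - T x‖ ≤ 4 * k * ‖y - x‖ := by
    rintro x ⟨p, -, hx⟩
    refine norm_sub_le_of_le_add_mul_sq hk hG (le_add_mul_sq_of_max (p := p) hG hF fun y => ?_)
    linarith [hx y]
  have hP : LipschitzOnWith (10 * k).toNNReal P K := by
    refine LipschitzOnWith.of_dist_le_mul fun y _ x hx => ?_
    rw [dist_eq_norm, dist_eq_norm, Real.coe_toNNReal _ (by positivity)]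
    have h1 : P y - P x = (S y - S x) + (T y - T x) - (2 * k) • (y - x) := by
      simp only [P, smul_sub]
      abel
    calc ‖P y - P x‖ ≤ ‖S y - S x‖ + ‖T y - T x‖ + ‖(2 * k) • (y - x)‖ := by
          rw [h1]
          exact (norm_sub_le _ _).trans (by gcongr; exact norm_add_le _ _)
      _ ≤ 4 * k * ‖y - x‖ + 4 * k * ‖y - x‖ + 2 * k * ‖y - x‖ := by
          rw [norm_smul, Real.norm_of_nonneg (by positivity)]
          gcongr
          · exact hSK x hx y
          · exact hTK x hx y
      _ = 10 * k * ‖y - x‖ := by ring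
  set N : Set E := {x | x ∈ K ∧ ¬ (DifferentiableAt ℝ S x ∧ DifferentiableAt ℝ T x)}
  have hN : μ N = 0 := by
    have : ∀ᵐ x ∂μ, x ∈ K → DifferentiableAt ℝ S x ∧ DifferentiableAt ℝ T x := by
      filter_upwards [ae_differentiableAt_of_pointwise_lipschitz μ hSK,
        ae_differentiableAt_of_pointwise_lipschitz μ hTK] with x h1 h2 hx
      exact ⟨h1 hx, h2 hx⟩
    rw [ae_iff] at this
    convert this using 2
    ext x
    simp [N]
  have hPN : μ (P '' N) = 0 := by
    have h1 := (hP.mono (show N ⊆ K from fun x hx => hx.1)).hausdorffMeasure_image_le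
      (d := (Module.finrank ℝ E : ℝ)) (by positivity)
    have hN' : Measure.hausdorffMeasure (Module.finrank ℝ E : ℝ) N = 0 := hN
    rw [hN', mul_zero] at h1
    exact le_antisymm h1 (zero_le)
  -- By the first order condition, `P` recovers the slope `p` from a maximum point, so a slope
  -- outside the null set `P '' N` has only good maximum points.
  obtain ⟨p, hp, hpN⟩ : ∃ p ∈ ball (0 : E) δ, p ∉ P '' N := by
    by_contra! hcon
    have h1 : μ (ball (0 : E) δ) ≤ μ (P '' N) := measure_mono hcon
    rw [hPN] at h1
    exact absurd h1 (not_le.2 (measure_ball_pos μ 0 hδ))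
  rw [mem_ball, dist_zero_right] at hp
  obtain ⟨x, hx⟩ := hmax p hp
  refine ⟨p, x, hp, hx, ?_⟩
  by_contra hd
  exact hpN ⟨x, ⟨⟨p, hp, hx⟩, hd⟩, add_eq_of_max hF hG hx⟩

end Subgradient

/-! ### Quadratic test functions. -/

section Quadratic

variable {E : Type*} [NormedAddCommGroup E] [InnerProductSpace ℝ E]

theorem contDiff_quadratic (ℓ y : E)
    (L : E →L[ℝ] E) :
    ContDiff ℝ 2 (fun z => ⟪ℓ, z - y⟫ + ⟪L (z - y), z - y⟫ / 2) := by
  have hz : ContDiff ℝ 2 (fun z : E => z - y) := contDiff_id.sub contDiff_const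
  exact (contDiff_const.inner ℝ hz).add (((L.contDiff.comp hz).inner ℝ hz).div_const 2)

/-- `L` need not be symmetric: on the diagonal only its symmetric part counts. So symmetry of the
derivative of a subgradient selection is never required. -/
theorem fderiv_fderiv_quadratic (ℓ y x : E)
    (L : E →L[ℝ] E) :
    fderiv ℝ (fderiv ℝ (fun z => ⟪ℓ, z - y⟫ + ⟪L (z - y), z - y⟫ / 2)) y x x = ⟪L x, x⟫ := by
  set Q : E →L[ℝ] E →L[ℝ] ℝ := (innerSL ℝ).comp L
  have h1 : fderiv ℝ (fun z => ⟪ℓ, z - y⟫ + ⟪L (z - y), z - y⟫ / 2) =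
      fun z => innerSL ℝ ℓ + ((2 : ℝ)⁻¹ • (Q + Q.flip)) (z - y) := by
    ext1 z
    have hz : HasFDerivAt (fun z : E => z - y)
      (ContinuousLinearMap.id ℝ _) z := (hasFDerivAt_id z).sub_const y
    have hq := ((((hasFDerivAt_const ℓ z).inner ℝ hz)).add
      (((L.hasFDerivAt.comp z hz).inner ℝ hz).mul_const (2 : ℝ)⁻¹)).fderiv
    simp only [Function.comp_def, Pi.add_def] at hq
    simp only [div_eq_mul_inv]
    refine Eq.trans hq ?_
    ext h
    simp [Q, real_inner_comm, inner_sub_left, inner_sub_right]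
    ring
  rw [h1]
  have h2 : HasFDerivAt (fun z => innerSL ℝ ℓ + ((2 : ℝ)⁻¹ • (Q + Q.flip)) (z - y))
      ((2 : ℝ)⁻¹ • (Q + Q.flip)) y :=
    (((2 : ℝ)⁻¹ • (Q + Q.flip)).hasFDerivAt.comp y ((hasFDerivAt_id y).sub_const y)).const_add _
  rw [h2.fderiv]
  simp [Q]
  ring

end Quadratic

section TestFunctions

variable {n : ℕ}

theorem inner_toEuclideanLin_hessian (φ : EuclideanSpace ℝ (Fin n) → ℝ)
    (y x : EuclideanSpace ℝ (Fin n)) :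
    ⟪x, Matrix.toEuclideanLin (hessian φ y) x⟫ = fderiv ℝ (fderiv ℝ φ) y x x := by
  have hx : x = ∑ i, x i • EuclideanSpace.single i (1 : ℝ) := by
    simpa using ((EuclideanSpace.basisFun (Fin n) ℝ).sum_repr x).symm
  have h1 : fderiv ℝ (fderiv ℝ φ) y x x = ∑ i, ∑ j, x i * (x j * hessian φ y i j) := by
    conv_lhs => rw [hx]
    simp only [map_sum, map_smul, sum_apply, smul_apply, smul_eq_mul,
      Finset.mul_sum, hessian, Matrix.of_apply]
    rw [Finset.sum_comm]
    exact Finset.sum_congr rfl fun i _ => Finset.sum_congr rfl fun j _ => by ring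
  rw [h1, PiLp.inner_apply]
  refine Finset.sum_congr rfl fun i _ => ?_
  simp only [Matrix.toLpLin_apply, Matrix.mulVec, dotProduct, RCLike.inner_apply, conj_trivial,
    Finset.sum_mul]
  exact Finset.sum_congr rfl fun j _ => by ring

theorem IsViscositySubsolution.exists_le_phase {c : ℝ} {Ω : Set (EuclideanSpace ℝ (Fin n))}
    {u : EuclideanSpace ℝ (Fin n) → ℝ} (hu : IsViscositySubsolution c Ω u)
    {y ℓ : EuclideanSpace ℝ (Fin n)} (hy : y ∈ Ω)
    {L : EuclideanSpace ℝ (Fin n) →L[ℝ] EuclideanSpace ℝ (Fin n)}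
    (h : ∀ᶠ z in 𝓝 y, u z ≤ u y + ⟪ℓ, z - y⟫ + ⟪L (z - y), z - y⟫ / 2) :
    ∃ X : Matrix (Fin n) (Fin n) ℝ, X.IsHermitian ∧
      (∀ x, ⟪x, Matrix.toEuclideanLin X x⟫ = ⟪L x, x⟫) ∧ c ≤ phase X := by
  have hφ := (contDiff_quadratic ℓ y L).contDiffAt (x := y)
  refine ⟨_, hessian_isHermitian hφ, fun x => ?_, hu y hy _ hφ ?_⟩
  · rw [inner_toEuclideanLin_hessian, fderiv_fderiv_quadratic]
  · filter_upwards [h] with z hz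
    simp only [sub_self, inner_zero_right, zero_div, add_zero, sub_zero]
    linarith

theorem IsViscositySupersolution.exists_phase_le {c : ℝ} {Ω : Set (EuclideanSpace ℝ (Fin n))}
    {v : EuclideanSpace ℝ (Fin n) → ℝ} (hv : IsViscositySupersolution c Ω v)
    {y ℓ : EuclideanSpace ℝ (Fin n)} (hy : y ∈ Ω)
    {L : EuclideanSpace ℝ (Fin n) →L[ℝ] EuclideanSpace ℝ (Fin n)}
    (h : ∀ᶠ z in 𝓝 y, v y + ⟪ℓ, z - y⟫ + ⟪L (z - y), z - y⟫ / 2 ≤ v z) :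
    ∃ X : Matrix (Fin n) (Fin n) ℝ, X.IsHermitian ∧
      (∀ x, ⟪x, Matrix.toEuclideanLin X x⟫ = ⟪L x, x⟫) ∧ phase X ≤ c := by
  have hφ := (contDiff_quadratic ℓ y L).contDiffAt (x := y)
  refine ⟨_, hessian_isHermitian hφ, fun x => ?_, hv y hy _ hφ ?_⟩
  · rw [inner_toEuclideanLin_hessian, fderiv_fderiv_quadratic]
  · filter_upwards [h] with z hz
    simp only [sub_self, inner_zero_right, zero_div, add_zero, sub_zero]
    linarith

end TestFunctions

/-! ### Sup-convolutions over a compact set. -/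

section SupConvolution

variable {E : Type*} [NormedAddCommGroup E] [InnerProductSpace ℝ E]

/-- `F` is the supremum over `C` of the affine functions `x ↦ f y - k / 2 * ‖y‖² + k * ⟪x, y⟫`,
attained at `y = s x`; so `F - k / 2 * ‖·‖²` is the sup-convolution of `f` over `C`. -/
structure IsSupConvolution (k : ℝ) (C : Set E) (f F : E → ℝ) (s : E → E) : Prop where
  mem : ∀ x, s x ∈ C
  eq : ∀ x, F x = f (s x) - k / 2 * ‖s x‖ ^ 2 + k * ⟪x, s x⟫
  le : ∀ x, ∀ y ∈ C, f y - k / 2 * ‖y‖ ^ 2 + k * ⟪x, y⟫ ≤ F x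

theorem exists_isSupConvolution (k : ℝ) {C : Set E} (hC : IsCompact C) (hne : C.Nonempty)
    {f : E → ℝ} (hf : UpperSemicontinuousOn f C) : ∃ F s, IsSupConvolution k C f F s := by
  have h : ∀ x : E, ∃ y ∈ C, ∀ z ∈ C,
      f z + (k * ⟪x, z⟫ - k / 2 * ‖z‖ ^ 2) ≤ f y + (k * ⟪x, y⟫ - k / 2 * ‖y‖ ^ 2) := by
    intro x
    have hc : Continuous fun z : E => k * ⟪x, z⟫ - k / 2 * ‖z‖ ^ 2 := by fun_prop
    exact UpperSemicontinuousOn.exists_isMaxOn hne hC (hf.add hc.continuousOn.upperSemicontinuousOn)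
  choose s hs hmax using h
  refine ⟨fun x => f (s x) - k / 2 * ‖s x‖ ^ 2 + k * ⟪x, s x⟫, s, hs, fun _ => rfl, ?_⟩
  intro x y hy
  linarith [hmax x y hy]

namespace IsSupConvolution

variable {k : ℝ} {C : Set E} {f g F G : E → ℝ} {s t : E → E}

theorem subgradient (h : IsSupConvolution k C f F s) (x y : E) :
    F x + ⟪k • s x, y - x⟫ ≤ F y := by
  have h1 := h.le y (s x) (h.mem x)
  rw [h.eq x, real_inner_smul_left, inner_sub_right, real_inner_comm y, real_inner_comm x]
  linarith

/-- Second order expansions of the sup-convolution transfer to one-sided ones of `f`. -/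
theorem eventually_le (h : IsSupConvolution k C f F s) {x : E} {A : E →L[ℝ] E}
    (hA : HasFDerivAt (fun x => k • s x) A x) (hC : C ∈ 𝓝 (s x)) {σ : ℝ} (hσ : 0 < σ) :
    ∀ᶠ z in 𝓝 (s x), f z ≤ f (s x) + ⟪k • (s x - x), z - s x⟫ +
      (⟪A (z - s x), z - s x⟫ - (k - 2 * σ) * ‖z - s x‖ ^ 2) / 2 := by
  have hlim : Tendsto (fun z => z - s x) (𝓝 (s x)) (𝓝 0) :=
    Continuous.tendsto' (by fun_prop) _ _ (sub_self _)
  filter_upwards [hC, hlim.eventually (eventually_abs_sub_quadratic_le h.subgradient hA hσ)]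
    with z hz hq
  -- Moving both arguments by the same vector keeps the penalty `k / 2 * ‖x - y‖²` unchanged, so `f`
  -- inherits the expansion of the sup-convolution.
  have h1 := h.le (x + (z - s x)) z hz
  have h2 := (abs_le.1 hq).2
  rw [h.eq x] at h2
  obtain ⟨w, rfl⟩ : ∃ w, z = s x + w := ⟨z - s x, by abel⟩
  simp only [add_sub_cancel_left] at h1 h2 ⊢
  rw [norm_add_sq_real] at h1
  simp only [inner_add_left, inner_add_right, real_inner_smul_left, inner_sub_left,
    real_inner_self_eq_norm_sq, real_inner_comm (s x) w] at h1 h2 ⊢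
  linarith

/-- For fixed `y`, `y'` the maximum over `x` is found by completing the square, at `x = (2 * k)⁻¹ •
(k • (y + y') - p)`. What remains is upper semicontinuous on the compact `C ×ˢ C`. -/
theorem exists_max (hk : 0 < k) (hC : IsCompact C) (hne : C.Nonempty)
    (hf : UpperSemicontinuousOn f C) (hg : UpperSemicontinuousOn g C)
    (hF : IsSupConvolution k C f F s) (hG : IsSupConvolution k C g G t) (p : E) :
    ∃ x, ∀ y, F y + G y - k * ‖y‖ ^ 2 ≤ F x + G x - k * ‖x‖ ^ 2 + ⟪p, y - x⟫ := by
  have hc : Continuous fun q : E × E => ‖k • (q.1 + q.2) - p‖ ^ 2 / (4 * k)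
      - k / 2 * ‖q.1‖ ^ 2 - k / 2 * ‖q.2‖ ^ 2 := by fun_prop
  have hf' : UpperSemicontinuousOn (fun q : E × E => f q.1) (C ×ˢ C) :=
    hf.comp continuousOn_fst fun q hq => hq.1
  have hg' : UpperSemicontinuousOn (fun q : E × E => g q.2) (C ×ˢ C) :=
    hg.comp continuousOn_snd fun q hq => hq.2
  obtain ⟨⟨y, y'⟩, ⟨hy, hy'⟩, hmax⟩ := UpperSemicontinuousOn.exists_isMaxOn (hne.prod hne)
    (hC.prod hC) ((hf'.add hg').add hc.continuousOn.upperSemicontinuousOn)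
  have hsq : ∀ x q : E, ⟪x, q⟫ - k * ‖x‖ ^ 2 = ‖q‖ ^ 2 / (4 * k) - ‖q - (2 * k) • x‖ ^ 2 / (4 * k) := by
    intro x q
    rw [norm_sub_sq_real, real_inner_smul_right, norm_smul, Real.norm_of_nonneg (by positivity),
      real_inner_comm]
    field_simp
    ring
  set q := k • (y + y') - p with hq
  refine ⟨(2 * k)⁻¹ • q, fun z => ?_⟩
  have h0 : q - (2 * k) • ((2 * k)⁻¹ • q) = 0 := by
    rw [smul_smul, mul_inv_cancel₀ (by positivity), one_smul, sub_self]
  have h1 := hF.le ((2 * k)⁻¹ • q) y hy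
  have h2 := hG.le ((2 * k)⁻¹ • q) y' hy'
  have h3 := hsq ((2 * k)⁻¹ • q) q
  rw [h0, norm_zero, zero_pow two_ne_zero, zero_div, sub_zero] at h3
  have h4 := hsq z (k • (s z + t z) - p)
  have h5 : 0 ≤ ‖k • (s z + t z) - p - (2 * k) • z‖ ^ 2 / (4 * k) := by positivity
  have h6 := hmax (show (s z, t z) ∈ C ×ˢ C from ⟨hF.mem z, hG.mem z⟩)
  simp only [mem_ofPred_eq] at h6
  rw [← hq] at h6
  set x := (2 * k)⁻¹ • q
  rw [hF.eq z, hG.eq z]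
  have h7 : ⟪x, q⟫ = k * ⟪x, y⟫ + k * ⟪x, y'⟫ - ⟪p, x⟫ := by
    rw [hq, inner_sub_right, real_inner_smul_right, inner_add_right, real_inner_comm x p]
    ring
  simp only [inner_sub_right, real_inner_smul_right, inner_add_right] at h4 ⊢
  rw [real_inner_comm p z] at h4
  linarith

end IsSupConvolution

end SupConvolution

/-! ### Localization of the maximum points. -/

section Doubling

/-- The pairs with value at least `a` and a component outside `Ω` form a compact set missing the
diagonal, so their distances are bounded below. -/
theorem exists_pos_forall_dist_lt_mem {E : Type*} [MetricSpace E] {C Ω : Set E} {f g : E → ℝ}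
    {a : ℝ} (hC : IsCompact C) (hΩ : IsOpen Ω)
    (hf : UpperSemicontinuousOn f C) (hg : UpperSemicontinuousOn g C)
    (hlt : ∀ z ∈ C, z ∉ Ω → f z + g z < a) :
    ∃ ρ > 0, ∀ y ∈ C, ∀ y' ∈ C, a ≤ f y + g y' → dist y y' < ρ → y ∈ Ω ∧ y' ∈ Ω := by
  have hf' : UpperSemicontinuousOn (fun q : E × E => f q.1) (C ×ˢ C) :=
    hf.comp continuousOn_fst fun q hq => hq.1
  have hg' : UpperSemicontinuousOn (fun q : E × E => g q.2) (C ×ˢ C) :=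
    hg.comp continuousOn_snd fun q hq => hq.2
  have hD := (hf'.add hg').isCompact_inter_preimage_Ici (hC.prod hC) a
  have hcl : IsClosed {q : E × E | q.1 ∉ Ω ∨ q.2 ∉ Ω} :=
    (hΩ.isClosed_compl.preimage continuous_fst).union (hΩ.isClosed_compl.preimage continuous_snd)
  obtain ⟨ρ, hρ, H⟩ := (hD.inter_right hcl).exists_forall_le' (f := fun q : E × E => dist q.1 q.2)
    (a := 0) continuous_dist.continuousOn (by
      rintro ⟨y, y'⟩ ⟨⟨⟨hy, hy'⟩, ha⟩, hn⟩
      refine dist_pos.2 fun heq => ?_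
      simp only at heq
      subst heq
      have : y ∉ Ω := by simpa using hn
      exact absurd (hlt y hy this) (not_lt.2 ha))
  refine ⟨ρ, hρ, fun y hy y' hy' ha hd => ?_⟩
  by_contra hcon
  have := H (y, y') ⟨⟨⟨hy, hy'⟩, ha⟩, by simpa [or_iff_not_imp_left] using hcon⟩
  exact absurd hd (not_lt.2 this)

/-- For a strong enough penalization and small enough linear perturbations, the maximum points of
the doubled functional stay in `Ω`. -/
theorem exists_penalization {E : Type*} [NormedAddCommGroup E] [InnerProductSpace ℝ E]
    {C Ω : Set E} {f g : E → ℝ} {a : ℝ} (hC : IsCompact C) (hΩ : IsOpen Ω)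
    (hf : UpperSemicontinuousOn f C) (hg : UpperSemicontinuousOn g C)
    (hlt : ∀ z ∈ C, z ∉ Ω → f z + g z < a) {x₀ : E} (hx₀ : x₀ ∈ C) (ha : a < f x₀ + g x₀) :
    ∃ k > 0, ∃ δ > 0, ∀ p x, ‖p‖ < δ → ∀ y ∈ C, ∀ y' ∈ C,
      f x₀ + g x₀ ≤ f y + g y' - k / 2 * ‖x - y‖ ^ 2 - k / 2 * ‖x - y'‖ ^ 2 + ⟪p, x₀ - x⟫ →
      y ∈ Ω ∧ y' ∈ Ω := by
  obtain ⟨ρ, hρ, hmem⟩ := exists_pos_forall_dist_lt_mem hC hΩ hf hg hlt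
  obtain ⟨M, hM⟩ := hf.bddAbove_of_isCompact hC
  obtain ⟨M', hM'⟩ := hg.bddAbove_of_isCompact hC
  obtain ⟨R, hR, hCR⟩ := hC.isBounded.exists_pos_norm_le
  set b := f x₀ + g x₀
  have hMb : b ≤ M + M' := add_le_add (hM ⟨x₀, hx₀, rfl⟩) (hM' ⟨x₀, hx₀, rfl⟩)
  -- `Q` will bound `k / 4 * (r ^ 2 + r' ^ 2)`. In `k`, the `4` absorbs the linear growth of the
  -- perturbation, `4 * Q` gives `r ≤ 1`, and `8 * Q / ρ ^ 2` gives `r + r' < ρ`.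
  set Q := M + M' - b + 2 * R + 1
  have hQ : 0 < Q := by simp only [Q]; linarith
  set k := 4 + 4 * Q + 8 * Q / ρ ^ 2
  have hk4 : 4 ≤ k := by
    have : 0 ≤ 8 * Q / ρ ^ 2 := by positivity
    simp only [k]; linarith
  have hkQ : 4 * Q ≤ k := by
    have : 0 ≤ 8 * Q / ρ ^ 2 := by positivity
    simp only [k]; linarith
  have hkρ : 8 * Q < k * ρ ^ 2 := by
    have e : k * ρ ^ 2 = (4 + 4 * Q) * ρ ^ 2 + 8 * Q := by
      simp only [k]; field_simp
    have : 0 < (4 + 4 * Q) * ρ ^ 2 := by positivity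
    linarith
  have hk : 0 < k := by linarith
  refine ⟨k, hk, min 1 ((b - a) / (2 * R + 1)), lt_min one_pos (div_pos (by linarith) (by linarith)),
    fun p x hp y hy y' hy' H => ?_⟩
  have hp1 : ‖p‖ ≤ 1 := hp.le.trans (min_le_left _ _)
  have hp2 : ‖p‖ * (2 * R + 1) ≤ b - a := by
    rw [← le_div_iff₀ (by linarith)]
    exact hp.le.trans (min_le_right _ _)
  set r := ‖x - y‖ with hr
  set r' := ‖x - y'‖ with hr'
  have hr0 : 0 ≤ r := norm_nonneg _
  have hr0' : 0 ≤ r' := norm_nonneg _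
  have hfy : f y ≤ M := hM ⟨y, hy, rfl⟩
  have hgy : g y' ≤ M' := hM' ⟨y', hy', rfl⟩
  have hdist : ‖x₀ - x‖ ≤ 2 * R + r := by
    calc ‖x₀ - x‖ = ‖x₀ - y - (x - y)‖ := by congr 1; abel
      _ ≤ ‖x₀‖ + ‖y‖ + ‖x - y‖ := (norm_sub_le _ _).trans (by gcongr; exact norm_sub_le _ _)
      _ ≤ 2 * R + r := by linarith [hCR x₀ hx₀, hCR y hy]
  have hin : ⟪p, x₀ - x⟫ ≤ ‖p‖ * (2 * R + r) :=
    (real_inner_le_norm _ _).trans (by gcongr)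
  have hin1 : ‖p‖ * (2 * R + r) ≤ 2 * R + r := mul_le_of_le_one_left (by linarith) hp1
  have hsq : k / 4 * (r ^ 2 + r' ^ 2) ≤ Q := by
    have : r ≤ r ^ 2 + 1 := by nlinarith [sq_nonneg (r - 1)]
    have h2 : 4 * r ^ 2 ≤ k * r ^ 2 := by gcongr
    have h3 : 0 ≤ k * r' ^ 2 := by positivity
    simp only [Q]
    linarith
  have hr1 : r ≤ 1 := by
    by_contra! h1
    have h2 : 1 < r ^ 2 := by nlinarith
    have h3 : 0 ≤ r' ^ 2 := by positivity
    nlinarith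
  have hval : a ≤ f y + g y' := by
    have h1 : ‖p‖ * (2 * R + r) ≤ ‖p‖ * (2 * R + 1) := by gcongr
    have h2 : 0 ≤ k / 2 * r ^ 2 := by positivity
    have h3 : 0 ≤ k / 2 * r' ^ 2 := by positivity
    linarith
  refine hmem y hy y' hy' hval ?_
  have hd : dist y y' ≤ r + r' := by
    rw [dist_comm y, dist_eq_norm]
    calc ‖y' - y‖ = ‖(x - y) - (x - y')‖ := by congr 1; abel
      _ ≤ r + r' := norm_sub_le _ _
  refine hd.trans_lt (lt_of_pow_lt_pow_left₀ 2 hρ.le ?_)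
  have h1 : (r + r') ^ 2 ≤ 2 * (r ^ 2 + r' ^ 2) := by nlinarith [sq_nonneg (r - r')]
  nlinarith

end Doubling

/-! ### The comparison principle. -/

/-- Comparison principle for the special Lagrangian equation with constant phase. -/
theorem le_of_viscosity {n : ℕ} (hn : 0 < n) {c : ℝ}
    {Ω : Set (EuclideanSpace ℝ (Fin n))} (hΩ : IsOpen Ω) (hΩb : Bornology.IsBounded Ω)
    {u v : EuclideanSpace ℝ (Fin n) → ℝ}
    (hu : UpperSemicontinuousOn u (closure Ω)) (hv : LowerSemicontinuousOn v (closure Ω))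
    (hsub : IsViscositySubsolution c Ω u) (hsuper : IsViscositySupersolution c Ω v)
    (hbd : ∀ x ∈ frontier Ω, u x ≤ v x) {x₀ : EuclideanSpace ℝ (Fin n)} (hx₀ : x₀ ∈ Ω) :
    u x₀ ≤ v x₀ := by
  by_contra! hlt
  set m := u x₀ - v x₀
  have hm : 0 < m := sub_pos.2 hlt
  set C := closure Ω
  have hC : IsCompact C := hΩb.isCompact_closure
  have hΩC : Ω ⊆ C := subset_closure
  have hne : C.Nonempty := ⟨x₀, hΩC hx₀⟩
  obtain ⟨R, hR, hCR⟩ := hC.isBounded.exists_pos_norm_le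
  -- The added quadratic is at most `m / 4` on `C`, so the boundary values stay below `m / 2`.
  set η := m / (2 * R ^ 2)
  have hη : 0 < η := by positivity
  have hηR : η / 2 * R ^ 2 = m / 4 := by
    simp only [η]
    field_simp
    norm_num
  set f : EuclideanSpace ℝ (Fin n) → ℝ := fun z => u z + η / 2 * ‖z‖ ^ 2
  set g : EuclideanSpace ℝ (Fin n) → ℝ := fun z => -v z
  have hf : UpperSemicontinuousOn f C := by
    have hc : Continuous fun z : EuclideanSpace ℝ (Fin n) => η / 2 * ‖z‖ ^ 2 := by fun_prop
    exact hu.add hc.continuousOn.upperSemicontinuousOn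
  have hg : UpperSemicontinuousOn g C := upperSemicontinuousOn_neg_iff.2 hv
  have hfg : ∀ z ∈ C, z ∉ Ω → f z + g z < m / 2 := by
    intro z hz hzΩ
    have h1 : u z ≤ v z := hbd z ⟨hz, by rwa [hΩ.interior_eq]⟩
    have h2 : η / 2 * ‖z‖ ^ 2 ≤ η / 2 * R ^ 2 := by
      gcongr
      exact hCR z hz
    simp only [f, g]
    linarith
  have hfg₀ : m / 2 < f x₀ + g x₀ := by
    have : 0 ≤ η / 2 * ‖x₀‖ ^ 2 := by positivity
    simp only [f, g]
    linarith
  obtain ⟨k, hk, δ, hδ, hpen⟩ := exists_penalization hC hΩ hf hg hfg (hΩC hx₀) hfg₀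
  obtain ⟨F, s, hF⟩ := exists_isSupConvolution k hC hne hf
  obtain ⟨G, t, hG⟩ := exists_isSupConvolution k hC hne hg
  obtain ⟨p, x, hp, hx, hS, hT⟩ := exists_max_differentiableAt hk hF.subgradient hG.subgradient hδ
    fun p _ => hF.exists_max hk hC hne hf hg hG p
  obtain ⟨hsx, htx⟩ := hpen p x hp (s x) (hF.mem x) (t x) (hG.mem x) (by
    have h1 := hx x₀
    have h2 := hF.le x₀ x₀ (hΩC hx₀)
    have h3 := hG.le x₀ x₀ (hΩC hx₀)
    rw [real_inner_self_eq_norm_sq] at h2 h3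
    rw [hF.eq x, hG.eq x] at h1
    rw [norm_sub_sq_real, norm_sub_sq_real]
    linarith)
  -- The expansion errors cost `8 * σ` of the gap `η` between the forms of `X` and `Y`, leaving `η /
  -- 2`.
  set σ := η / 16
  have hσ : 0 < σ := by positivity
  set A := fderiv ℝ (fun x => k • s x) x
  set B := fderiv ℝ (fun x => k • t x) x
  have hA : HasFDerivAt (fun x => k • s x) A x := hS.hasFDerivAt
  have hB : HasFDerivAt (fun x => k • t x) B x := hT.hasFDerivAt
  have hAB := inner_add_inner_le_of_max hF.subgradient hG.subgradient hx hA hB hσ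
  have hCs : C ∈ 𝓝 (s x) := mem_of_superset (hΩ.mem_nhds hsx) hΩC
  have hCt : C ∈ 𝓝 (t x) := mem_of_superset (hΩ.mem_nhds htx) hΩC
  obtain ⟨X, hX, hXq, hXc⟩ := hsub.exists_le_phase hsx
    (ℓ := k • (s x - x) - η • s x)
    (L := A - (k + η - 2 * σ) • ContinuousLinearMap.id ℝ _) (by
      filter_upwards [hF.eventually_le hA hCs hσ] with z hz
      obtain ⟨w, rfl⟩ : ∃ w, z = s x + w := ⟨z - s x, by abel⟩
      simp only [f, norm_add_sq_real, add_sub_cancel_left] at hz ⊢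
      simp only [sub_apply, smul_apply,
        ContinuousLinearMap.id_apply, inner_sub_left, real_inner_smul_left,
        real_inner_self_eq_norm_sq] at hz ⊢
      linarith)
  obtain ⟨Y, hY, hYq, hYc⟩ := hsuper.exists_phase_le htx
    (ℓ := -(k • (t x - x)))
    (L := (k - 2 * σ) • ContinuousLinearMap.id ℝ _ - B) (by
      filter_upwards [hG.eventually_le hB hCt hσ] with z hz
      obtain ⟨w, rfl⟩ : ∃ w, z = t x + w := ⟨z - t x, by abel⟩
      simp only [g, add_sub_cancel_left] at hz ⊢
      simp only [sub_apply, smul_apply,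
        ContinuousLinearMap.id_apply, inner_sub_left, inner_neg_left, real_inner_smul_left,
        real_inner_self_eq_norm_sq] at hz ⊢
      linarith)
  refine absurd (phase_lt_phase hn hX hY fun h hh => ?_) (not_lt.2 (hYc.trans hXc))
  rw [hXq, hYq]
  have h1 := hAB h
  have h2 : 0 < η * ‖h‖ ^ 2 := by positivity
  simp only [sub_apply, smul_apply,
    ContinuousLinearMap.id_apply, inner_sub_left, real_inner_smul_left,
    real_inner_self_eq_norm_sq]
  have h3 : σ * ‖h‖ ^ 2 = η * ‖h‖ ^ 2 / 16 := by
    simp only [σ]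
    ring
  linarith

end SpecialLagrangian

theorem theorem6p1 {n : ℕ} (hn : 0 < n) (c : ℝ)
    (Ω : Set (EuclideanSpace ℝ (Fin n))) (hΩ : IsOpen Ω) (hΩb : Bornology.IsBounded Ω)
    (u v : EuclideanSpace ℝ (Fin n) → ℝ)
    (hu : UpperSemicontinuousOn u (closure Ω)) (hv : LowerSemicontinuousOn v (closure Ω))
    (hsub : SpecialLagrangian.IsViscositySubsolution c Ω u)
    (hsuper : SpecialLagrangian.IsViscositySupersolution c Ω v)
    (hbd : ∀ x ∈ frontier Ω, u x ≤ v x) :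
    ∀ x ∈ Ω, u x ≤ v x := by
  exact fun x hx =>
    SpecialLagrangian.le_of_viscosity hn hΩ hΩb hu hv hsub hsuper hbd hx
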